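/- Let $G$ be a finite group of order $n$, and let $\mathcal{P}_s(G)$ be its strong power graph: the simple graph whose vertices are the elements of $G$, two distinct vertices $a,b$ being adjacent if and only if $a^{m_1}=b^{m_2}$ for some positive integers $m_1,m_2<n$. Let $\tau(\mathcal{P}_s(G))$ denote the number of spanning trees of $\mathcal{P}_s(G)$ (subgraphs that contain all vertices and are trees), and let $\phi$ be Euler's totient function. 1. If $G$ is cyclic and $n\ge 2$, then $\tau(\mathcal{P}_s(G))=n^{\,n-\phi(n)-2}\,(n-\phi(n)-1)\,(n-1)^{\phi(n)-1}$. 2. If $G$ is noncyclic, then $\tau(\mathcal{P}_s(G))=n^{\,n-2}$. -/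

import Mathlib

/-- The strong power graph of a finite group `G` of order `n`: the vertices are the elements of `G`,
and two distinct vertices `a`, `b` are adjacent iff `a ^ m₁ = b ^ m₂` for some positive integers
`m₁, m₂ < n`. -/
def strongPowerGraph (G : Type*) [Group G] : SimpleGraph G where
  Adj a b := a ≠ b ∧ ∃ m₁ m₂ : ℕ,
    0 < m₁ ∧ m₁ < Nat.card G ∧ 0 < m₂ ∧ m₂ < Nat.card G ∧ a ^ m₁ = b ^ m₂
  symm := ⟨by
    rintro a b ⟨hab, m₁, m₂, h₁, h₁', h₂, h₂', h⟩
    exact ⟨hab.symm, m₂, m₁, h₂, h₂', h₁, h₁', h.symm⟩⟩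
  loopless := ⟨fun _ h => h.1 rfl⟩

/-- The set of spanning trees of a graph: the subgraphs that contain every vertex and are trees. -/
def spanningTrees {V : Type*} (Γ : SimpleGraph V) : Set Γ.Subgraph :=
  {T | T.IsSpanning ∧ T.coe.IsTree}

/-- The number of spanning trees of a graph (used for finite graphs). -/
noncomputable def numSpanningTrees {V : Type*} (Γ : SimpleGraph V) : ℕ :=
  (spanningTrees Γ).ncard

/-! Powers `a ^ orderOf a` join any two non-generators, and a generator has every nonidentity
element among its powers; so the graph is complete except that `1` misses the generators
(`strongPowerGraph_adj_iff`). The count for a complete graph minus a star comes from the matrix tree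
theorem: spanning trees correspond to parent maps towards a root, which are the surviving terms when
the Laplacian determinant is expanded row by row. That determinant is explicit, a diagonal matrix
times two rank-one perturbations of the identity. -/

open Finset Matrix Function

/-! ### Spanning trees as rooted parent maps -/

section Counting

variable {V : Type*}

/-- The graph joining every vertex `x` to its parent `f x`. -/
def parentGraph (f : V → V) : SimpleGraph V := SimpleGraph.fromRel fun x y => f x = y

/-- The self-map `f` is the parent map of a tree rooted at `v`: it fixes `v` and every vertex is
sent to `v` by some iterate. -/
def IsParentMap (v : V) (f : V → V) : Prop := f v = v ∧ ∀ x, ∃ k, f^[k] x = v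

/-- Induction principle: every nonempty `f`-stable set contains the root. -/
theorem IsParentMap.eq_of_map_eq {v : V} {f : V → V} (hf : IsParentMap v f) {s : Set V}
    (hs : ∀ x ∈ s, f x ∈ s) {x : V} (hx : x ∈ s) : v ∈ s := by
  obtain ⟨k, hk⟩ := hf.2 x
  rw [← hk]
  clear hk
  induction k with
  | zero => exact hx
  | succ k ih => rw [iterate_succ_apply']; exact hs _ ih

theorem IsParentMap.map_ne {v : V} {f : V → V} (hf : IsParentMap v f) {x : V} (hx : x ≠ v) :
    f x ≠ x := fun h =>
  hx (hf.eq_of_map_eq (s := {x}) (by rintro y rfl; exact h) rfl : v = x).symm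

theorem IsParentMap.map_map_ne {v : V} {f : V → V} (hf : IsParentMap v f) {x : V} (hx : x ≠ v) :
    f (f x) ≠ x := fun h => by
  have hv : v ∈ ({x, f x} : Set V) := hf.eq_of_map_eq
    (by rintro y (rfl | rfl) <;> simp [h]) (Set.mem_insert x _)
  rcases hv with hv | hv
  · exact hx hv.symm
  · rw [Set.mem_singleton_iff] at hv
    rw [← hv, hf.1] at h
    exact hx h.symm

theorem IsParentMap.connected_parentGraph {v : V} {f : V → V} (hf : IsParentMap v f) :
    (parentGraph f).Connected := by
  have step : ∀ x, (parentGraph f).Reachable x (f x) := fun x => by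
    by_cases h : x = f x
    · rw [← h]
    · exact SimpleGraph.Adj.reachable ((SimpleGraph.fromRel_adj _ _ _).2 ⟨h, Or.inl rfl⟩)
  have reach : ∀ x, (parentGraph f).Reachable x v := fun x => by
    have : v ∈ {y | (parentGraph f).Reachable x y} :=
      hf.eq_of_map_eq (fun y hy => SimpleGraph.Reachable.trans hy (step y))
        (SimpleGraph.Reachable.refl x)
    exact this
  have : Nonempty V := ⟨v⟩
  exact ⟨fun x y => (reach x).trans (reach y).symm⟩

theorem IsParentMap.isTree_parentGraph [Finite V] {v : V} {f : V → V} (hf : IsParentMap v f) :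
    (parentGraph f).IsTree := by
  classical
  have := Fintype.ofFinite V
  refine SimpleGraph.isTree_iff_connected_and_card.2 ⟨hf.connected_parentGraph, ?_⟩
  refine le_antisymm ?_ hf.connected_parentGraph.card_vert_le_card_edgeSet_add_one
  have hsub : (parentGraph f).edgeSet ⊆
      ((univ.erase v).image fun x => s(x, f x) : Finset (Sym2 V)) := by
    intro e
    induction e with
    | _ x y =>
      simp only [SimpleGraph.mem_edgeSet, parentGraph, SimpleGraph.fromRel_adj]
      rintro ⟨hne, h | h⟩
      · have hx : x ≠ v := by rintro rfl; exact hne (hf.1.symm.trans h)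
        exact mem_coe.2 (mem_image.2 ⟨x, by simpa using hx, by rw [h]⟩)
      · have hy : y ≠ v := by rintro rfl; exact hne (h.symm.trans hf.1)
        exact mem_coe.2 (mem_image.2 ⟨y, by simpa using hy, by rw [h, Sym2.eq_swap]⟩)
  have h1 := Set.ncard_le_ncard hsub (Finset.finite_toSet _)
  rw [Set.ncard_coe_finset] at h1
  have h2 := h1.trans card_image_le
  rw [card_erase_of_mem (mem_univ v), card_univ, ← Nat.card_eq_fintype_card] at h2
  have : 0 < Nat.card V := Nat.card_pos_iff.2 ⟨⟨v⟩, inferInstance⟩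
  rw [Nat.card_coe_set_eq]
  omega

/-- The disagreement set of `f` and `g` is `f`-stable: there the edge from `x` to `f x` forces `g (f
x) = x`, whereas `f` has no 2-cycle. The root is not in this set. -/
theorem parentGraph_injOn (v : V) : Set.InjOn parentGraph {f : V → V | IsParentMap v f} := by
  intro f hf g hg hfg
  by_contra hne
  obtain ⟨x, hx⟩ := Function.ne_iff.1 hne
  refine (hf.eq_of_map_eq (s := {x | f x ≠ g x}) (fun x hx => ?_) hx) (hf.1.trans hg.1.symm)
  have hxv : x ≠ v := by rintro rfl; exact hx (hf.1.trans hg.1.symm)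
  have hadj : (parentGraph f).Adj x (f x) :=
    (SimpleGraph.fromRel_adj _ _ _).2 ⟨(hf.map_ne hxv).symm, Or.inl rfl⟩
  rw [hfg] at hadj
  have hg' : g (f x) = x := by
    rcases ((SimpleGraph.fromRel_adj _ _ _).1 hadj).2 with h | h
    · exact absurd h.symm hx
    · exact h
  change f (f x) ≠ g (f x)
  rw [hg']
  exact hf.map_map_ne hxv

theorem SimpleGraph.IsTree.exists_isParentMap {T : SimpleGraph V} (hT : T.IsTree) (v : V) :
    ∃ f, IsParentMap v f ∧ parentGraph f = T := by
  classical
  -- The parent is a neighbour one step closer to the root.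
  have key : ∀ x, ∃ y, (x = v → y = v) ∧ (x ≠ v → T.Adj x y ∧ T.dist y v + 1 = T.dist x v) := by
    intro x
    by_cases hx : x = v
    · exact ⟨v, fun _ => rfl, fun h => absurd hx h⟩
    · obtain ⟨p, hp⟩ := hT.connected.exists_walk_length_eq_dist x v
      cases p with
      | nil => exact absurd rfl hx
      | @cons _ y _ h q =>
        refine ⟨y, fun h => absurd h hx, fun _ => ⟨h, ?_⟩⟩
        have h1 := SimpleGraph.dist_le q
        have h2 := hT.connected.dist_triangle (u := x) (v := y) (w := v)
        rw [SimpleGraph.dist_eq_one_iff_adj.2 h] at h2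
        rw [SimpleGraph.Walk.length_cons] at hp
        omega
  choose f hfv hf using key
  have hp : IsParentMap v f := by
    refine ⟨hfv v rfl, fun x => ?_⟩
    induction hd : T.dist x v using Nat.strong_induction_on generalizing x with
    | _ d ih =>
      by_cases hx : x = v
      · exact ⟨0, hx⟩
      · obtain ⟨k, hk⟩ := ih (T.dist (f x) v) (by have := (hf x hx).2; omega) (f x) rfl
        exact ⟨k + 1, hk⟩
  refine ⟨f, hp, ?_⟩
  have hle : parentGraph f ≤ T := by
    have main : ∀ x y, x ≠ y → f x = y → T.Adj x y := by
      rintro x _ hne rfl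
      exact (hf x fun h => hne (h.trans (hfv x h).symm)).1
    intro x y h
    obtain ⟨hne, h | h⟩ := (SimpleGraph.fromRel_adj _ _ _).1 h
    · exact main x y hne h
    · exact (main y x hne.symm h).symm
  exact le_antisymm hle
    ((SimpleGraph.isTree_iff_minimal_connected.1 hT).2 hp.connected_parentGraph hle)

theorem numSpanningTrees_eq_ncard (Γ : SimpleGraph V) :
    numSpanningTrees Γ = {T : SimpleGraph V | T ≤ Γ ∧ T.IsTree}.ncard := by
  refine Set.ncard_congr (fun T _ => T.spanningCoe) ?_ ?_ ?_
  · rintro T ⟨hs, ht⟩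
    exact ⟨T.spanningCoe_le, (T.spanningCoeEquivCoeOfSpanning hs).isTree_iff.2 ht⟩
  · rintro S T ⟨hs, -⟩ ⟨ht, -⟩ h
    exact SimpleGraph.Subgraph.ext (hs.verts_eq_univ.trans ht.verts_eq_univ.symm)
      (congrArg SimpleGraph.Adj h)
  · rintro T ⟨hle, ht⟩
    have hs := SimpleGraph.toSubgraph.isSpanning T hle
    refine ⟨SimpleGraph.toSubgraph T hle, ⟨hs, ?_⟩, ?_⟩
    · exact (SimpleGraph.Subgraph.spanningCoeEquivCoeOfSpanning _ hs).isTree_iff.1 ht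
    · rfl

theorem numSpanningTrees_eq_ncard_isParentMap [Finite V] (Γ : SimpleGraph V) (v : V) :
    numSpanningTrees Γ = {f : V → V | IsParentMap v f ∧ ∀ x ≠ v, Γ.Adj x (f x)}.ncard := by
  rw [numSpanningTrees_eq_ncard]
  refine (Set.ncard_congr (fun f _ => parentGraph f) ?_ ?_ ?_).symm
  · rintro f ⟨hf, h⟩
    have main : ∀ x y, x ≠ y → f x = y → Γ.Adj x y := by
      rintro x _ hne rfl
      exact h x fun hx => by subst hx; exact hne hf.1.symm
    refine ⟨fun x y hxy => ?_, hf.isTree_parentGraph⟩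
    obtain ⟨hne, h | h⟩ := (SimpleGraph.fromRel_adj _ _ _).1 hxy
    · exact main x y hne h
    · exact (main y x hne.symm h).symm
  · rintro f g ⟨hf, -⟩ ⟨hg, -⟩ h
    exact parentGraph_injOn v hf hg h
  · rintro T ⟨hle, hT⟩
    obtain ⟨f, hf, rfl⟩ := hT.exists_isParentMap v
    exact ⟨f, ⟨hf, fun x hx => hle ((SimpleGraph.fromRel_adj _ _ _).2
      ⟨(hf.map_ne hx).symm, Or.inl rfl⟩)⟩, rfl⟩

end Counting

/-! ### The matrix tree theorem -/

section MatrixTree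

variable {V : Type*} [Fintype V] [DecidableEq V]

/-- The adjacency matrix of the functional digraph of `f`, with the row of `v` cleared. -/
def parentMatrix (v : V) (f : V → V) : Matrix V V ℚ :=
  Matrix.of fun x y => if x ≠ v ∧ f x = y then 1 else 0

theorem parentMatrix_mulVec (v : V) (f : V → V) (g : V → ℚ) (x : V) :
    (parentMatrix v f *ᵥ g) x = if x = v then 0 else g (f x) := by
  by_cases hx : x = v <;> simp [parentMatrix, mulVec, dotProduct, hx]

theorem IsParentMap.isNilpotent_parentMatrix {v : V} {f : V → V} (hf : IsParentMap v f) :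
    IsNilpotent (parentMatrix v f) := by
  have main : ∀ k x, f^[k] x = v → ∀ N, k < N → ∀ g : V → ℚ,
      (parentMatrix v f ^ N *ᵥ g) x = 0 := by
    intro k
    induction k with
    | zero =>
      rintro x rfl N hN g
      obtain ⟨N, rfl⟩ := Nat.exists_eq_succ_of_ne_zero hN.ne'
      rw [pow_succ', ← mulVec_mulVec, parentMatrix_mulVec]
      simp
    | succ k ih =>
      intro x hx N hN g
      obtain ⟨N, rfl⟩ := Nat.exists_eq_succ_of_ne_zero (Nat.zero_lt_of_lt hN).ne'
      rw [pow_succ', ← mulVec_mulVec, parentMatrix_mulVec, ih (f x) hx N (by omega), ite_self]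
  choose k hk using hf.2
  refine ⟨∑ x, k x + 1, ?_⟩
  ext x y
  have := main (k x) x (hk x) (∑ x, k x + 1)
    (Nat.lt_succ_of_le (single_le_sum (f := k) (fun _ _ => Nat.zero_le _) (mem_univ x)))
    (Pi.single y 1)
  simpa using this

/-- The characteristic polynomial is a power of `X`; evaluate it at 1. -/
theorem Matrix.det_one_sub_of_isNilpotent {M : Matrix V V ℚ} (hM : IsNilpotent M) :
    (1 - M).det = 1 := by
  have h := sub_eq_zero.1 (isNilpotent_charpoly_sub_pow_of_isNilpotent hM).eq_zero
  have h1 := congrArg (Polynomial.eval 1) h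
  simpa [Matrix.eval_charpoly] using h1

open Classical in
theorem det_one_sub_parentMatrix {v : V} {f : V → V} (hv : f v = v) :
    (1 - parentMatrix v f).det = if IsParentMap v f then 1 else 0 := by
  split_ifs with hf
  · exact det_one_sub_of_isNilpotent hf.isNilpotent_parentMatrix
  · obtain ⟨x, hx⟩ : ∃ x, ∀ k, f^[k] x ≠ v := by
      by_contra! h
      exact hf ⟨hv, h⟩
    refine exists_mulVec_eq_zero_iff.1
      -- Kernel vector: the indicator of the vertices that never reach `v`.
      ⟨fun y => if ∃ k, f^[k] y = v then 0 else 1, fun h => ?_, ?_⟩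
    · simpa [hx] using congrFun h x
    · ext y
      rw [sub_mulVec, one_mulVec, Pi.sub_apply, parentMatrix_mulVec]
      by_cases hy : y = v
      · simp [hy, show ∃ k, f^[k] v = v from ⟨0, rfl⟩]
      · have : (∃ k, f^[k] (f y) = v) ↔ ∃ k, f^[k] y = v := by
          refine ⟨fun ⟨k, hk⟩ => ⟨k + 1, hk⟩, ?_⟩
          rintro ⟨_ | k, hk⟩
          · exact absurd hk hy
          · exact ⟨k, hk⟩
        simp [hy, this]

/-- The Laplacian matrix with the row of the root `v` replaced by the basis vector at `v`. -/
def rootedLaplacian (Γ : SimpleGraph V) [DecidableRel Γ.Adj] (v : V) : Matrix V V ℚ :=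
  Matrix.of fun x => if x = v then Pi.single v 1 else Γ.lapMatrix ℚ x

/-- Kirchhoff's matrix tree theorem. -/
theorem det_rootedLaplacian (Γ : SimpleGraph V) [DecidableRel Γ.Adj] (v : V) :
    (rootedLaplacian Γ v).det = numSpanningTrees Γ := by
  classical
  let A : V → Finset V := fun x => if x = v then {v} else Γ.neighborFinset x
  -- A Laplacian row is the sum of `e_x - e_y` over neighbours `y`; the root's only choice is `v`,
  -- contributing `e_v`.
  let g : V → V → V → ℚ := fun x y => (1 : Matrix V V ℚ) x - if x = v then 0 else Pi.single y 1
  have hrow : rootedLaplacian Γ v = fun x => ∑ y ∈ A x, g x y := by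
    ext x z
    by_cases hx : x = v
    · subst hx
      simp [rootedLaplacian, A, g, Matrix.one_apply, Pi.single_apply, eq_comm]
    · simp [rootedLaplacian, A, g, hx, SimpleGraph.lapMatrix, SimpleGraph.degMatrix,
        Matrix.one_apply, Matrix.diagonal_apply, Pi.single_apply, SimpleGraph.adjMatrix_apply,
        sum_ite_eq]
  have hdet : (rootedLaplacian Γ v).det =
      ∑ f ∈ Fintype.piFinset A, (1 - parentMatrix v f).det := by
    rw [hrow]
    refine (MultilinearMap.map_sum_finset
      (detRowAlternating (n := V) (R := ℚ)).toMultilinearMap g A).trans ?_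
    refine sum_congr rfl fun f _ => congrArg Matrix.det ?_
    ext x z
    by_cases hx : x = v
    · simp [g, parentMatrix, hx]
    · simp [g, parentMatrix, hx, Pi.single_apply, eq_comm (a := z)]
  have hmem : ∀ f, f ∈ Fintype.piFinset A ↔ f v = v ∧ ∀ x ≠ v, Γ.Adj x (f x) := by
    intro f
    rw [Fintype.mem_piFinset]
    refine ⟨fun h => ⟨by simpa [A] using h v, fun x hx => by simpa [A, hx] using h x⟩, ?_⟩
    rintro ⟨h1, h2⟩ x
    by_cases hx : x = v
    · simp [A, hx, h1]
    · simpa [A, hx] using h2 x hx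
  rw [hdet, sum_congr rfl fun f hf => det_one_sub_parentMatrix ((hmem f).1 hf).1, sum_boole,
    numSpanningTrees_eq_ncard_isParentMap Γ v, ← Set.ncard_coe_finset]
  congr 2
  ext f
  simp only [coe_filter, Set.mem_ofPred_eq, hmem]
  exact ⟨fun h => ⟨h.2, h.1.2⟩, fun h => ⟨⟨h.1.1, h.2⟩, h.1⟩⟩

/-! ### Determinant for a complete graph minus a star -/

theorem Matrix.det_one_add_vecMulVec (u w : V → ℚ) :
    (1 + vecMulVec u w).det = 1 + w ⬝ᵥ u := by
  rw [vecMulVec_eq Unit, det_one_add_replicateCol_mul_replicateRow]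

/-- The number of spanning trees of a complete graph with a star removed. -/
theorem numSpanningTrees_of_complete_minus_star (Γ : SimpleGraph V) (v : V) (B : Finset V)
    (hv : v ∉ B) (hV : 2 ≤ Fintype.card V)
    (hΓ : ∀ x y, Γ.Adj x y ↔ x ≠ y ∧ ¬(x = v ∧ y ∈ B) ∧ ¬(y = v ∧ x ∈ B)) :
    (numSpanningTrees Γ : ℚ) =
      (Fintype.card V : ℚ) ^ ((Fintype.card V : ℤ) - (#B : ℤ) - 2) *
        ((Fintype.card V : ℚ) - (#B : ℚ) - 1) * ((Fintype.card V : ℚ) - 1) ^ ((#B : ℤ) - 1) := by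
  classical
  set n := Fintype.card V with hn
  have hn0 : (n : ℚ) ≠ 0 := by positivity
  have hn1 : (n : ℚ) - 1 ≠ 0 := by
    have : (2 : ℚ) ≤ n := by exact_mod_cast hV
    linarith
  -- Off the root, `c` is degree plus one, and row `x` is `c x • e_x - 1`, plus `e_v` if `x ∈ B`.
  -- Dividing by `c x` gives `z` and `w`; `z v = 0` kills the cross term in `hfac`.
  let c : V → ℚ := fun x => if x = v then 1 else if x ∈ B then (n : ℚ) - 1 else n
  have hc : ∀ x, c x ≠ 0 := fun x => by simp only [c]; split_ifs <;> simp [hn0, hn1]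
  let w : V → ℚ := fun x => if x ∈ B then (c x)⁻¹ else 0
  let z : V → ℚ := fun x => if x = v then 0 else -(c x)⁻¹
  have hdeg : ∀ x ≠ v, (Γ.degree x : ℚ) + 1 = c x := by
    intro x hx
    rw [← Γ.card_neighborFinset_eq_degree]
    by_cases hB : x ∈ B
    · have : Γ.neighborFinset x = (univ.erase x).erase v := by
        ext y
        simp [hΓ, hx, hB, eq_comm, and_comm]
      rw [this, card_erase_of_mem (by simp [Ne.symm hx]), card_erase_of_mem (mem_univ x),
        card_univ, ← hn, Nat.sub_sub, Nat.cast_sub hV]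
      simp [c, hx, hB]
      ring
    · have : Γ.neighborFinset x = univ.erase x := by
        ext y
        simp [hΓ, hx, hB, eq_comm]
      rw [this, card_erase_of_mem (mem_univ x), card_univ, ← hn, Nat.cast_sub (by omega)]
      simp [c, hx, hB]
  have hfac : rootedLaplacian Γ v = diagonal c * ((1 + vecMulVec w (Pi.single v 1)) *
      (1 + vecMulVec z fun _ => 1)) := by
    ext x y
    have hzv : z v = 0 := by simp [z]
    have hR : ((1 + vecMulVec w (Pi.single v 1)) * (1 + vecMulVec z fun _ => 1) : Matrix V V ℚ) x y =
        (1 : Matrix V V ℚ) x y + z x + w x * (Pi.single v 1 : V → ℚ) y := by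
      rw [Matrix.add_mul, Matrix.mul_add, vecMulVec_mul, Matrix.vecMul_add, vecMul_one,
        vecMul_vecMulVec]
      simp [vecMulVec_apply, hzv]
    rw [diagonal_mul, hR]
    by_cases hx : x = v
    · subst hx
      simp [rootedLaplacian, c, z, w, hv, Matrix.one_apply, Pi.single_apply, eq_comm]
    · have hcx := hc x
      simp only [rootedLaplacian, hx, Matrix.of_apply, if_false, SimpleGraph.lapMatrix,
        SimpleGraph.degMatrix, Matrix.sub_apply, SimpleGraph.adjMatrix_apply, hΓ,
        Matrix.diagonal_apply, Matrix.one_apply, Pi.single_apply, z, w, false_and, not_false_eq_true,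
        true_and, ← hdeg x hx] at hcx ⊢
      by_cases hxy : x = y
      · subst hxy
        simp [hx]
        field_simp
        ring
      · by_cases hy : y = v <;> by_cases hB : x ∈ B <;> simp [hxy, hy, hB, hx] <;> field_simp
  have hBv : B ⊆ univ.erase v := fun x hx => by
    simp only [mem_erase, mem_univ, and_true]
    rintro rfl
    exact hv hx
  have hcard : #((univ.erase v) \ B) = n - 1 - #B := by
    rw [card_sdiff_of_subset hBv, card_erase_of_mem (mem_univ v), card_univ]
  have hBn : #B ≤ n - 1 := by
    have := card_le_card hBv
    rwa [card_erase_of_mem (mem_univ v), card_univ] at this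
  have hcB : ∀ x ∈ B, c x = (n : ℚ) - 1 := fun x hx => by
    have : x ≠ v := by rintro rfl; exact hv hx
    simp [c, this, hx]
  have hcC : ∀ x ∈ (univ.erase v) \ B, c x = n := fun x hx => by
    simp only [mem_sdiff, mem_erase, mem_univ, and_true] at hx
    simp [c, hx]
  have hprod : ∏ x, c x = (n : ℚ) ^ (n - 1 - #B) * ((n : ℚ) - 1) ^ #B := by
    rw [← mul_prod_erase univ c (mem_univ v), ← prod_sdiff hBv, prod_congr rfl hcC,
      prod_congr rfl hcB, prod_const, prod_const, hcard]
    simp [c]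
  have hsum : ∑ x, z x = -(((n : ℚ) - 1 - #B) * (n : ℚ)⁻¹ + #B * ((n : ℚ) - 1)⁻¹) := by
    have hz : ∀ x ∈ univ.erase v, z x = -(c x)⁻¹ := fun x hx => by simp [z, (mem_erase.1 hx).1]
    rw [← add_sum_erase univ z (mem_univ v), sum_congr rfl hz, sum_neg_distrib, ← sum_sdiff hBv,
      sum_congr rfl fun x hx => congrArg Inv.inv (hcC x hx),
      sum_congr rfl fun x hx => congrArg Inv.inv (hcB x hx), sum_const, sum_const, hcard, nsmul_eq_mul, nsmul_eq_mul, Nat.cast_sub hBn,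
      Nat.cast_sub (by omega)]
    simp [z]
  have hwv : w v = 0 := by simp [w, hv]
  -- Integer powers are needed: either exponent can be -1.
  rw [← det_rootedLaplacian Γ v, hfac, det_mul, det_mul, det_diagonal, hprod,
    det_one_add_vecMulVec, det_one_add_vecMulVec, single_dotProduct, hwv,
    show (fun _ => (1 : ℚ)) ⬝ᵥ z = ∑ x, z x by simp [dotProduct], hsum,
    show (n : ℤ) - #B - 2 = ((n - 1 - #B : ℕ) : ℤ) - 1 by omega, zpow_sub₀ hn0, zpow_sub₀ hn1,
    zpow_natCast, zpow_natCast, zpow_one, zpow_one]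
  field_simp
  ring

end MatrixTree

/-! ### Adjacency in the strong power graph -/

section StrongPowerGraph

variable {G : Type*} [Group G]

theorem strongPowerGraph_adj_of_orderOf_lt [Finite G] {a b : G} (hab : a ≠ b)
    (ha : orderOf a < Nat.card G)
    (hb : orderOf b < Nat.card G) : (strongPowerGraph G).Adj a b :=
  ⟨hab, orderOf a, orderOf b, orderOf_pos a, ha, orderOf_pos b, hb, by
    rw [pow_orderOf_eq_one, pow_orderOf_eq_one]⟩

theorem strongPowerGraph_adj_of_orderOf_eq [Finite G] {a b : G} (hab : a ≠ b)
    (ha : orderOf a = Nat.card G)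
    (hb : b ≠ 1) : (strongPowerGraph G).Adj a b := by
  classical
  have hmem : b ∈ Subgroup.zpowers a := by
    rw [Subgroup.eq_top_of_card_eq _ ((Nat.card_zpowers a).trans ha)]
    trivial
  obtain ⟨k, hk, rfl⟩ := (IsOfFinOrder.mem_zpowers_iff_mem_range_orderOf
    (isOfFinOrder_of_finite a)).trans mem_image |>.1 hmem
  have hk' : k < Nat.card G := by rw [← ha]; exact mem_range.1 hk
  have hk0 : 0 < k := Nat.pos_of_ne_zero fun h => hb (by rw [h, pow_zero])
  exact ⟨hab, k, 1, hk0, hk', one_pos, by omega, by rw [pow_one]⟩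

theorem strongPowerGraph_not_adj_one {b : G} (hb : orderOf b = Nat.card G) :
    ¬(strongPowerGraph G).Adj 1 b := by
  rintro ⟨-, m₁, m₂, -, -, h0, h, heq⟩
  rw [one_pow] at heq
  exact absurd (Nat.le_of_dvd h0 (orderOf_dvd_of_pow_eq_one heq.symm)) (by omega)

theorem strongPowerGraph_adj_iff [Finite G] (a b : G) :
    (strongPowerGraph G).Adj a b ↔ a ≠ b ∧ ¬(a = 1 ∧ orderOf b = Nat.card G) ∧
      ¬(b = 1 ∧ orderOf a = Nat.card G) := by
  constructor
  · refine fun h => ⟨h.1, ?_, ?_⟩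
    · rintro ⟨rfl, hb⟩
      exact strongPowerGraph_not_adj_one hb h
    · rintro ⟨rfl, ha⟩
      exact strongPowerGraph_not_adj_one ha h.symm
  · rintro ⟨hab, h1, h2⟩
    by_cases ha : orderOf a = Nat.card G
    · exact strongPowerGraph_adj_of_orderOf_eq hab ha fun hb => h2 ⟨hb, ha⟩
    by_cases hb : orderOf b = Nat.card G
    · exact (strongPowerGraph_adj_of_orderOf_eq hab.symm hb fun ha => h1 ⟨ha, hb⟩).symm
    exact strongPowerGraph_adj_of_orderOf_lt hab (lt_of_le_of_ne orderOf_le_card ha)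
      (lt_of_le_of_ne orderOf_le_card hb)

end StrongPowerGraph

theorem corollary4p5 {G : Type*} [Group G] [Finite G] (n : ℕ) (hn : Nat.card G = n) :
    (IsCyclic G → 2 ≤ n →
      (numSpanningTrees (strongPowerGraph G) : ℚ) =
        (n : ℚ) ^ ((n : ℤ) - (Nat.totient n : ℤ) - 2) * ((n : ℚ) - (Nat.totient n : ℚ) - 1) *
          ((n : ℚ) - 1) ^ ((Nat.totient n : ℤ) - 1)) ∧
    (¬ IsCyclic G →
      numSpanningTrees (strongPowerGraph G) = n ^ (n - 2)) := by
  classical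
  have := Fintype.ofFinite G
  have hcard : Fintype.card G = n := by rw [← Nat.card_eq_fintype_card, hn]
  let B : Finset G := {x | orderOf x = n}
  have key : 2 ≤ n → (numSpanningTrees (strongPowerGraph G) : ℚ) =
      (n : ℚ) ^ ((n : ℤ) - (#B : ℤ) - 2) * ((n : ℚ) - (#B : ℚ) - 1) *
        ((n : ℚ) - 1) ^ ((#B : ℤ) - 1) := by
    intro h2
    have := numSpanningTrees_of_complete_minus_star (strongPowerGraph G) 1 B
      (by simp only [B, mem_filter, mem_univ, true_and, orderOf_one]; omega) (by omega)
      (fun x y => by simpa [B, hcard] using strongPowerGraph_adj_iff x y)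
    rwa [hcard] at this
  refine ⟨fun hc h2 => ?_, fun hc => ?_⟩
  · rw [key h2, IsCyclic.card_orderOf_eq_totient (by rw [hcard])]
  · have h2 : 2 ≤ n := by
      by_contra h
      have : Subsingleton G := Finite.card_le_one_iff_subsingleton.1 (by omega)
      exact hc inferInstance
    have hB : #B = 0 := by
      refine card_eq_zero.2 (filter_eq_empty_iff.2 fun x _ hx => hc ?_)
      exact isCyclic_of_orderOf_eq_card x (hx.trans hn.symm)
    have hn1 : (n : ℚ) - 1 ≠ 0 := by
      have : (2 : ℚ) ≤ n := by exact_mod_cast h2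
      linarith
    have h := key h2
    -- Without generators, the factor `n - 1` cancels `(n - 1) ^ (-1)`.
    rw [hB, show (n : ℤ) - ((0 : ℕ) : ℤ) - 2 = ((n - 2 : ℕ) : ℤ) by omega, zpow_natCast,
      Nat.cast_zero, sub_zero, mul_assoc, Nat.cast_zero, zero_sub, _root_.zpow_neg_one,
      mul_inv_cancel₀ hn1, mul_one] at h
    exact_mod_cast h
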